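/- Let $X$ be a finite, connected simplicial complex of dimension at least $1$. For $x\in X$, let $\operatorname{st}(x)$ be the union of all open simplices of $X$ whose closure contains $x$, and let $\operatorname{lk}(x)=\overline{\operatorname{st}(x)}\setminus\operatorname{st}(x)$; the point $x$ is a *boundary point* of $X$, written $x\in\partial X$, if $\operatorname{lk}(x)$ is homeomorphic to a closed disk $D^k$ for some $k\ge 0$. For a space $Y$ and $m\ge 0$ let $F_m(Y)=\{(y_1,\dots,y_m)\in Y^m : y_i\ne y_j \text{ for } i\neq j\}$ with the subspace topology, let $B_m(Y)=F_m(Y)/\mathbf{S}_m$ be the orbit space under permutation of coordinates, with the quotient topology, and let $\mathbf{B}_m(Y,c)=\pi_1(B_m(Y),c)$ be the $m$-braid group of $Y$ based at $c$. Let $v\in\partial X$ and $n\ge 1$, and let $i_v:B_{n-1}(X\setminus\{v\})\to B_n(X)$, $i_v(\mathbf{x})=\{v\}\cup\mathbf{x}$, be the point-appending map. Then: 1. for every base point $c\in B_{n-1}(X\setminus\{v\})$, the induced homomorphism $(i_v)_*:\mathbf{B}_{n-1}(X\setminus\{v\},c)\to\mathbf{B}_n(X,i_v(c))$ is injective; 2.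 the inclusion $B_{n-1}(X\setminus\{v\})\to B_{n-1}(X)$ is a homotopy equivalence, and for every homotopy inverse $h$ of it and every base point $c\in B_{n-1}(X)$, the homomorphism $(i_v\circ h)_*:\mathbf{B}_{n-1}(X,c)\to\mathbf{B}_n(X,i_v(h(c)))$ is injective. -/

import Mathlib

/-! ### Finite simplicial complexes, stars, links and boundary points -/

namespace Geometry.SimplicialComplex

variable {E : Type*} [NormedAddCommGroup E] [NormedSpace ℝ E]

/-- `K` is finite, connected (in particular nonempty), and of dimension at least `1`. -/
structure IsFiniteConnectedPosDim (K : Geometry.SimplicialComplex ℝ E) : Prop where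
  finite : K.faces.Finite
  connected : IsConnected K.space
  one_le_dim : ∃ s ∈ K.faces, 2 ≤ s.card

/-- The open simplex spanned by a finite set `s` of vertices: all convex combinations of the
points of `s` in which every weight is positive. -/
def openSimplex (s : Finset E) : Set E :=
  {x | ∃ w : E → ℝ, (∀ y ∈ s, 0 < w y) ∧ ∑ y ∈ s, w y = 1 ∧ ∑ y ∈ s, w y • y = x}

/-- The star of a subset `A`: the union of all open simplices of `K` whose closures meet `A`
(the closure of the open simplex of `s` is the convex hull of `s`). -/
def star (K : Geometry.SimplicialComplex ℝ E) (A : Set E) : Set E :=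
  {x | ∃ s ∈ K.faces, (convexHull ℝ (s : Set E) ∩ A).Nonempty ∧ x ∈ openSimplex s}

/-- The link of a subset `A`: the closure of the star of `A` minus the star of the closure
of `A`. -/
def link (K : Geometry.SimplicialComplex ℝ E) (A : Set E) : Set E :=
  closure (K.star A) \ K.star (closure A)

/-- `x` is a boundary point of the complex: its link is homeomorphic to a closed disk `D^k`
for some `k ≥ 0`. -/
def IsBoundaryPoint (K : Geometry.SimplicialComplex ℝ E) (x : E) : Prop :=
  x ∈ K.space ∧ ∃ k : ℕ,
    Nonempty (K.link {x} ≃ₜ Metric.closedBall (0 : EuclideanSpace ℝ (Fin k)) 1)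

end Geometry.SimplicialComplex

/-! ### Configuration spaces -/

/-- The ordered configuration space `F_n(X)`: `n`-tuples of distinct points of `X`, with the
topology of a subspace of `X^n`. -/
abbrev OrderedConf (n : ℕ) (X : Type*) : Type _ :=
  {x : Fin n → X // Function.Injective x}

namespace OrderedConf

/-- The symmetric group permutes the coordinates of an ordered configuration. -/
instance (n : ℕ) (X : Type*) : MulAction (Equiv.Perm (Fin n)) (OrderedConf n X) where
  smul σ x := ⟨fun i => x.1 (σ⁻¹ i), x.2.comp (σ⁻¹).injective⟩
  one_smul _ := rfl
  mul_smul _ _ _ := by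
    apply Subtype.ext
    funext i
    simp [HSMul.hSMul, mul_inv_rev]

theorem smul_apply {n : ℕ} {X : Type*} (σ : Equiv.Perm (Fin n)) (x : OrderedConf n X)
    (i : Fin n) : (σ • x).1 i = x.1 (σ⁻¹ i) := rfl

end OrderedConf

/-- The unordered configuration space `B_n(X)`: the orbit space of `F_n(X)` under the symmetric
group, with the quotient topology. -/
abbrev UnorderedConf (n : ℕ) (X : Type*) : Type _ :=
  MulAction.orbitRel.Quotient (Equiv.Perm (Fin n)) (OrderedConf n X)

/-- The `n`-braid group of `X` based at the configuration `c`. -/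
abbrev BraidGroup (n : ℕ) (X : Type*) [TopologicalSpace X] (c : UnorderedConf n X) : Type _ :=
  FundamentalGroup (UnorderedConf n X) c

namespace UnorderedConf

variable {X : Type*} [TopologicalSpace X]

/-- The inclusion `B_n(X ∖ {v}) → B_n(X)`, `[x_1, …, x_n] ↦ [x_1, …, x_n]`. -/
def inclusion (n : ℕ) (v : X) : C(UnorderedConf n {x : X // x ≠ v}, UnorderedConf n X) where
  toFun := Quotient.map (sa := MulAction.orbitRel _ _) (sb := MulAction.orbitRel _ _)
    (fun x => (⟨fun i => (x.1 i).1, Subtype.val_injective.comp x.2⟩ : OrderedConf n X)) (by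
      rintro _ y ⟨σ, rfl⟩
      exact ⟨σ, rfl⟩)
  continuous_toFun := by
    refine Continuous.quotient_map' ?_ _
    exact Continuous.subtype_mk (continuous_pi fun i => continuous_subtype_val.comp
      ((continuous_apply i).comp continuous_subtype_val)) _

/-- Adding `v` as a first coordinate to an ordered configuration in `X ∖ {v}`. -/
def consOrdered (n : ℕ) (v : X) (x : OrderedConf n {x : X // x ≠ v}) : OrderedConf (n + 1) X :=
  ⟨Fin.cons v fun i => (x.1 i).1, Fin.cons_injective_iff.2
    ⟨by rintro ⟨i, hi⟩; exact (x.1 i).2 hi, Subtype.val_injective.comp x.2⟩⟩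

/-- The point-appending map `i_v : B_n(X ∖ {v}) → B_{n+1}(X)`, `c ↦ {v} ∪ c`. -/
def append (n : ℕ) (v : X) : C(UnorderedConf n {x : X // x ≠ v}, UnorderedConf (n + 1) X) where
  toFun := Quotient.map (sa := MulAction.orbitRel _ _) (sb := MulAction.orbitRel _ _)
    (consOrdered n v) (by
      rintro _ y ⟨σ, rfl⟩
      refine ⟨Equiv.Perm.decomposeFin.symm (0, σ), ?_⟩
      apply Subtype.ext
      funext i
      obtain ⟨j, rfl⟩ := (Equiv.Perm.decomposeFin.symm (0, σ)).surjective i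
      simp only [OrderedConf.smul_apply, Equiv.Perm.inv_def, Equiv.symm_apply_apply]
      refine Fin.cases ?_ (fun j => ?_) j
      · simp [consOrdered]
      · simp [consOrdered, OrderedConf.smul_apply])
  continuous_toFun := by
    refine Continuous.quotient_map' ?_ _
    refine Continuous.subtype_mk ?_ _
    refine continuous_pi fun i => ?_
    refine Fin.cases ?_ (fun j => ?_) i
    · simpa using continuous_const
    · simp only [Fin.cons_succ]
      exact continuous_subtype_val.comp ((continuous_apply j).comp continuous_subtype_val)

end UnorderedConf

/-! The geometric input is an isotopy of embeddings of `X` that starts at the identity and moves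
everything off `v` (`exists_isotopy_of_cone`). The closed star of `v` is a cone over the link, a
disk. Writing a cone point at height `t` over a disk point `y` as `(t • y, t)`, the isotopy fixes `t
• y`, raises `t` for `t < 1`, and fixes the base `t = 1`, so it extends by the identity outside the
star. Applied pointwise to configurations, it makes the inclusion of `B_n(X ∖ {v})` into `B_n(X)` a
homotopy equivalence.

For injectivity (`map_append_injective`), let a loop in `B_n(X ∖ {v})` die after `v` is appended.
Order its points by lifting to the covering `F_n`, and put `v` in front. This lifts the appended
loop to `F_{n+1}(X)`, where the null-homotopy lifts too. Forgetting the first coordinate contracts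
the original loop inside `B_n(X)`, and the equivalence above shows that it was already trivial. The
second injectivity follows because a homotopy inverse is itself injective on `π₁`. -/

open Topology CategoryTheory

/-- A continuous map with a left homotopy inverse is injective on fundamental groups. -/
theorem FundamentalGroup.map_injective_of_comp_homotopic_id {X Y : Type*} [TopologicalSpace X]
    [TopologicalSpace Y] {f : C(X, Y)} {g : C(Y, X)}
    (h : (g.comp f).Homotopic (ContinuousMap.id X)) (x : X) :
    Function.Injective (FundamentalGroup.map f x) := by
  -- Groupoids avoid base-point bookkeeping: the homotopy is a natural isomorphism to the identity
  -- functor, so `f` induces a faithful functor.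
  have i : FundamentalGroupoid.map f ⋙ FundamentalGroupoid.map g ≅ 𝟭 _ :=
    eqToIso (FundamentalGroupoid.map_comp g f).symm ≪≫
      asIso (FundamentalGroupoidFunctor.homotopicMapsNatIso h.some) ≪≫
      eqToIso FundamentalGroupoid.map_id
  have : (FundamentalGroupoid.map f ⋙ FundamentalGroupoid.map g).Faithful :=
    Functor.Faithful.of_iso i.symm
  have : (FundamentalGroupoid.map f).Faithful := Functor.Faithful.of_comp _ (FundamentalGroupoid.map g)
  intro a b hab
  exact (FundamentalGroupoid.map f).map_injective hab

/-! ### Ordered configurations as a covering of unordered ones -/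

namespace OrderedConf

variable {n : ℕ} {X : Type*} [TopologicalSpace X]

instance : ContinuousConstSMul (Equiv.Perm (Fin n)) (OrderedConf n X) where
  continuous_const_smul σ := Continuous.subtype_mk (f := fun x : OrderedConf n X =>
    fun i => x.1 (σ⁻¹ i)) (continuous_pi fun i =>
      (continuous_apply (σ⁻¹ i)).comp continuous_subtype_val) _

theorem eq_one_of_smul_eq {X : Type*} {σ : Equiv.Perm (Fin n)} {x : OrderedConf n X}
    (h : σ • x = x) : σ = 1 := by
  rw [← inv_eq_one]
  ext i
  have := congrArg (fun y => y.1 i) h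
  simp only [smul_apply] at this
  simp [x.2 this]

/-- A free action of a finite group on a Hausdorff space: separate `x` from each of its other
translates, then intersect the finitely many neighbourhoods. -/
theorem isQuotientCoveringMap_mk [T2Space X] :
    IsQuotientCoveringMap (Quotient.mk (MulAction.orbitRel (Equiv.Perm (Fin n)) (OrderedConf n X)))
      (Equiv.Perm (Fin n)) where
  __ := isQuotientMap_quotient_mk'
  continuous_const_smul := continuous_const_smul
  apply_eq_iff_mem_orbit := Quotient.eq''
  disjoint x := by
    have key (σ : Equiv.Perm (Fin n)) :
        ∃ U ∈ 𝓝 x, ((σ • ·) '' U ∩ U).Nonempty → σ = 1 := by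
      by_cases hσ : σ = 1
      · exact ⟨Set.univ, Filter.univ_mem, fun _ => hσ⟩
      · obtain ⟨A, B, hA, hB, hxA, hxB, hAB⟩ :=
          t2_separation (fun h => hσ (eq_one_of_smul_eq h) : σ • x ≠ x)
        refine ⟨(σ • ·) ⁻¹' A ∩ B, Filter.inter_mem
          ((continuous_const_smul σ).continuousAt.preimage_mem_nhds (hA.mem_nhds hxA))
          (hB.mem_nhds hxB), ?_⟩
        rintro ⟨_, ⟨y, hy, rfl⟩, hy'⟩
        exact (Set.disjoint_left.1 hAB hy.1 hy'.2).elim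
    choose U hU hσ using key
    refine ⟨⋂ σ, U σ, Filter.iInter_mem.2 hU, fun σ h => hσ σ (h.mono ?_)⟩
    exact Set.inter_subset_inter (Set.image_mono (Set.iInter_subset _ _)) (Set.iInter_subset _ _)

/-- An injective map acts on ordered configurations. -/
def map {X Y : Type*} (f : X → Y) (hf : Function.Injective f) (x : OrderedConf n X) :
    OrderedConf n Y :=
  ⟨fun i => f (x.1 i), hf.comp x.2⟩

/-- Forgetting the first coordinate of an ordered configuration. -/
def tail (n : ℕ) (X : Type*) [TopologicalSpace X] : C(OrderedConf (n + 1) X, OrderedConf n X) where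
  toFun x := ⟨Fin.tail x.1, x.2.comp (Fin.succ_injective n)⟩
  continuous_toFun := Continuous.subtype_mk
    (continuous_pi fun i => (continuous_apply i.succ).comp continuous_subtype_val) _

end OrderedConf

/-! ### Homotopies and loops of unordered configurations -/

namespace UnorderedConf

variable {n : ℕ} {X Y A : Type*} [TopologicalSpace X] [TopologicalSpace Y] [TopologicalSpace A]

/-- A continuous family of injective maps induces a continuous family of maps between unordered
configuration spaces. -/
def mapFamily (n : ℕ) (F : C(A × X, Y)) (hF : ∀ a, Function.Injective fun x => F (a, x)) :
    C(A × UnorderedConf n X, UnorderedConf n Y) where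
  toFun p := Quotient.map (sa := MulAction.orbitRel (Equiv.Perm (Fin n)) (OrderedConf n X))
    (sb := MulAction.orbitRel (Equiv.Perm (Fin n)) (OrderedConf n Y))
    (OrderedConf.map _ (hF p.1)) (by
      rintro _ y ⟨σ, rfl⟩
      exact ⟨σ, rfl⟩) p.2
  continuous_toFun := by
    -- The orbit map is open, so its product with the identity of `A` is still a quotient map.
    have hq : IsOpenQuotientMap (Prod.map (id : A → A)
        (Quotient.mk (MulAction.orbitRel (Equiv.Perm (Fin n)) (OrderedConf n X)))) :=
      IsOpenQuotientMap.id.prodMap MulAction.isOpenQuotientMap_quotientMk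
    rw [hq.isQuotientMap.continuous_iff]
    refine continuous_quotient_mk'.comp (f := fun p : A × OrderedConf n X =>
      OrderedConf.map _ (hF p.1) p.2) ?_
    refine Continuous.subtype_mk (continuous_pi fun i => F.continuous.comp ?_) _
    exact continuous_fst.prodMk ((continuous_apply i).comp (continuous_subtype_val.comp continuous_snd))

/-- If `X` can be pushed off `v` by an isotopy of embeddings, then the inclusion
`B_n(X ∖ {v}) → B_n(X)` is a homotopy equivalence. -/
theorem exists_homotopyEquiv_inclusion (n : ℕ) {v : X} (F : C(unitInterval × X, X))
    (hF : ∀ s, Function.Injective fun x => F (s, x)) (h0 : ∀ x, F (0, x) = x)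
    (hv : ∀ s x, F (s, x) = v → s = 0 ∧ x = v) :
    ∃ e : ContinuousMap.HomotopyEquiv (UnorderedConf n {x : X // x ≠ v}) (UnorderedConf n X),
      e.toFun = inclusion n v := by
  -- The end of the isotopy, seen as a one-point family so that `mapFamily` applies to it.
  let r : C(Unit × X, {x : X // x ≠ v}) :=
    ⟨fun p => ⟨F (1, p.2), fun h => one_ne_zero (hv _ _ h).1⟩,
      Continuous.subtype_mk (F.continuous.comp (by fun_prop)) _⟩
  let G : C(unitInterval × {x : X // x ≠ v}, {x : X // x ≠ v}) :=
    ⟨fun p => ⟨F (p.1, p.2), fun h => p.2.2 (hv _ _ h).2⟩,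
      Continuous.subtype_mk (F.continuous.comp (by fun_prop)) _⟩
  have hr : ∀ a, Function.Injective fun x => r (a, x) := fun a x y h =>
    hF 1 (congrArg Subtype.val h)
  have hG : ∀ s, Function.Injective fun x => G (s, x) := fun s x y h =>
    Subtype.ext (hF s (congrArg Subtype.val h))
  refine ⟨⟨inclusion n v, (mapFamily n r hr).comp ((ContinuousMap.const _ ()).prodMk (.id _)),
    ⟨ContinuousMap.Homotopy.symm ⟨mapFamily n G hG, ?_, ?_⟩⟩,
    ⟨ContinuousMap.Homotopy.symm ⟨mapFamily n F hF, ?_, ?_⟩⟩⟩, rfl⟩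
  · rintro ⟨x⟩
    exact congrArg (Quotient.mk _) (Subtype.ext (funext fun i => Subtype.ext (h0 (x.1 i))) :
      OrderedConf.map _ (hG 0) x = x)
  · rintro ⟨x⟩
    rfl
  · rintro ⟨x⟩
    exact congrArg (Quotient.mk _) (Subtype.ext (funext fun i => h0 (x.1 i)) :
      OrderedConf.map _ (hF 0) x = x)
  · rintro ⟨x⟩
    rfl

/-- If the inclusion `B_n(X ∖ {v}) → B_n(X)` is injective on fundamental groups, then so is the
point-appending map. -/
theorem map_append_injective [T2Space X] {v : X} (c : UnorderedConf n {x : X // x ≠ v})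
    (h : Function.Injective (FundamentalGroup.map (inclusion n v) c)) :
    Function.Injective (FundamentalGroup.map (append n v) c) := by
  rw [injective_iff_map_eq_one]
  rintro ⟨γ⟩ hγ
  refine (injective_iff_map_eq_one _).1 h _ ?_
  have hγ' : (γ.map (append n v).continuous).Homotopic (Path.refl _) := Quotient.exact hγ
  refine Quotient.sound ?_
  obtain ⟨o, rfl⟩ := Quotient.mk_surjective c
  have cov := (OrderedConf.isQuotientCoveringMap_mk (n := n)
    (X := {x : X // x ≠ v})).isCoveringMap
  have cov' := (OrderedConf.isQuotientCoveringMap_mk (n := n + 1) (X := X)).isCoveringMap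
  let Γ := cov.liftPath γ o γ.source
  have hΓ : ∀ t, Quotient.mk _ (Γ t) = γ t := congrFun (cov.liftPath_lifts γ o γ.source)
  let Δ : C(unitInterval, OrderedConf (n + 1) X) := ⟨fun t => consOrdered n v (Γ t), by
    refine Continuous.subtype_mk (continuous_pi fun i => ?_) _
    refine Fin.cases ?_ (fun j => ?_) i
    · simpa using continuous_const
    · simp only [Fin.cons_succ]
      exact continuous_subtype_val.comp ((continuous_apply j).comp
        (continuous_subtype_val.comp Γ.continuous))⟩
  -- Both sides lift homotopic paths and agree at time `0`, so they are homotopic relative to both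
  -- ends; in particular the lift closes up.
  have hΔ : Δ.HomotopicRel (ContinuousMap.const unitInterval (consOrdered n v o)) {0, 1} := by
    refine (cov'.homotopicRel_iff_comp (S := ({0, 1} : Set unitInterval)) ⟨0, Or.inl rfl, ?_⟩).2 ?_
    · exact congrArg (consOrdered n v) (cov.liftPath_zero γ o γ.source)
    · have e : ContinuousMap.comp ⟨Quotient.mk _, cov'.continuous⟩ Δ =
          (γ.map (append n v).continuous).toContinuousMap :=
        ContinuousMap.ext fun t => congrArg (append n v) (hΓ t)
      rw [e]
      exact hγ'
  -- During the homotopy the other points may run through `v`, so forgetting the first coordinate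
  -- gives a contraction in `B_n(X)` only.
  let q : C(OrderedConf (n + 1) X, UnorderedConf n X) :=
    ContinuousMap.comp ⟨Quotient.mk _, continuous_quotient_mk'⟩ (OrderedConf.tail n X)
  obtain ⟨H⟩ := hΔ
  have H' := H.compContinuousMap q
  refine ⟨H'.cast ?_ ?_⟩
  · ext t
    exact congrArg (inclusion n v) (hΓ t)
  · rfl

end UnorderedConf

/-! ### The isotopy on a cone over a disk -/

/-- A point with a conical neighbourhood over a closed disk, in a compact Hausdorff space, can be
pushed off itself by an isotopy of embeddings. -/
theorem exists_isotopy_of_cone {X L V : Type*} [TopologicalSpace X] [CompactSpace X] [T2Space X]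
    [TopologicalSpace L] [NormedAddCommGroup V] [NormedSpace ℝ V] [ProperSpace V]
    (φ : L ≃ₜ Metric.closedBall (0 : V) 1) (Q : C(L × unitInterval, X)) {v : X}
    (hv : ∀ l, Q (l, 0) = v)
    (hQ : ∀ l t l' t', Q (l, t) = Q (l', t') → t = t' ∧ (t = 0 ∨ l = l'))
    (hopen : IsOpen (Q '' {p | p.2 ≠ 1})) :
    ∃ F : C(unitInterval × X, X), (∀ s, Function.Injective fun x => F (s, x)) ∧
      (∀ x, F (0, x) = x) ∧ ∀ s x, F (s, x) = v → s = 0 ∧ x = v := by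
  have : CompactSpace L := φ.symm.compactSpace
  set S := Q '' {p | p.2 ≠ 1}
  have : CompactSpace ↥(Sᶜ) := isCompact_iff_compactSpace.1 hopen.isClosed_compl.isCompact
  -- The new height. The factor `1/2` keeps the slope `1 - s / 2` in `t` positive even at `s = 1`,
  -- which gives injectivity.
  let τ : unitInterval → unitInterval → unitInterval := fun s t =>
    ⟨t + s / 2 * (1 - t), by
      constructor <;> nlinarith [s.2.1, s.2.2, t.2.1, t.2.2,
        mul_nonneg s.2.1 (sub_nonneg.2 t.2.2)]⟩
  have hτ : ∀ s t, (τ s t : ℝ) = t + s / 2 * (1 - t) := fun _ _ => rfl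
  have hle : ∀ s t : unitInterval, (t : ℝ) ≤ τ s t := fun s t => by
    rw [hτ]; nlinarith [mul_nonneg s.2.1 (sub_nonneg.2 t.2.2)]
  have hτ1 : ∀ s t, τ s t = 1 → t = 1 := fun s t h => by
    have h' : (τ s t : ℝ) = 1 := congrArg Subtype.val h
    rw [hτ] at h'
    apply Subtype.ext
    have := s.2.2
    show (t : ℝ) = 1
    have h2 : (1 - (t : ℝ)) * (1 - s / 2) = 0 := by linarith
    rcases mul_eq_zero.1 h2 with h3 | h3 <;> linarith
  have hτ0 : ∀ s t, τ s t = 0 → t = 0 ∧ s = 0 := fun s t h => by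
    have h' : (τ s t : ℝ) = 0 := congrArg Subtype.val h
    have ht : (t : ℝ) = 0 := le_antisymm ((hle s t).trans h'.le) t.2.1
    rw [hτ, ht] at h'
    exact ⟨Subtype.ext ht, Subtype.ext (by show (s : ℝ) = 0; linarith)⟩
  have hτinj : ∀ s t t', τ s t = τ s t' → t = t' := fun s t t' h => by
    have h' : (τ s t : ℝ) = τ s t' := congrArg Subtype.val h
    rw [hτ, hτ] at h'
    apply Subtype.ext
    have := s.2.2
    have h2 : ((t : ℝ) - t') * (1 - s / 2) = 0 := by linarith
    rcases mul_eq_zero.1 h2 with h3 | h3 <;> linarith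
  have hball : ∀ (s t : unitInterval) (l : L), ((t : ℝ) / τ s t) • (φ l : V) ∈ Metric.closedBall (0 : V) 1 :=
    fun s t l => by
      rw [mem_closedBall_zero_iff, norm_smul, Real.norm_of_nonneg (div_nonneg t.2.1 (τ s t).2.1)]
      exact mul_le_one₀ (div_le_one_of_le₀ (hle s t) (τ s t).2.1) (norm_nonneg _)
        (mem_closedBall_zero_iff.1 (φ l).2)
  -- Chosen so that height times disk point is preserved. At `t = s = 0` the quotient is `0 / 0 =
  -- 0`, a harmless value because `Q` collapses height `0` to `v`.
  let g : unitInterval × (L × unitInterval) → L := fun p =>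
    φ.symm ⟨((p.2.2 : ℝ) / τ p.1 p.2.2) • (φ p.2.1 : V), hball _ _ _⟩
  have hg : ∀ s l t, t ≠ 0 → ∀ l', g (s, l, t) = g (s, l', t) → l = l' := fun s l t ht l' h => by
    have h1 : ((t : ℝ) / τ s t) • (φ l : V) = ((t : ℝ) / τ s t) • (φ l' : V) :=
      congrArg Subtype.val (φ.symm.injective h)
    have h2 : (t : ℝ) / τ s t ≠ 0 := div_ne_zero (fun h => ht (Subtype.ext h))
      fun h => ht (hτ0 s t (Subtype.ext h)).1
    exact φ.injective (Subtype.ext (smul_right_injective V h2 h1))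
  have hg1 : ∀ s l t, t ≠ 0 → τ s t = t → g (s, l, t) = l := fun s l t ht h => by
    have : (⟨((t : ℝ) / τ s t) • (φ l : V), hball s t l⟩ : Metric.closedBall (0 : V) 1) = φ l := by
      apply Subtype.ext
      show ((t : ℝ) / τ s t) • (φ l : V) = φ l
      rw [h, div_self fun h => ht (Subtype.ext h), one_smul]
    show φ.symm _ = l
    rw [this, φ.symm_apply_apply]
  have hττ1 : ∀ s, τ s 1 = 1 := fun s => Subtype.ext (by rw [hτ]; simp)
  have hττ0 : ∀ t, τ 0 t = t := fun t => Subtype.ext (by rw [hτ]; simp)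
  have hτc : Continuous fun p : unitInterval × (L × unitInterval) => τ p.1 p.2.2 :=
    Continuous.subtype_mk (by fun_prop) _
  have hGc : Continuous fun p : unitInterval × (L × unitInterval) => Q (g p, τ p.1 p.2.2) := by
    rw [continuous_iff_continuousAt]
    rintro ⟨s, l, t⟩
    -- At the apex `g` need not be continuous; compactness of `L` makes `Q (l, r)` tend to `v`
    -- uniformly in `l` as `r` tends to `0`.
    by_cases h0 : τ s t = 0
    · unfold ContinuousAt
      simp only [h0, hv]
      rw [Filter.tendsto_def]
      intro U hU
      have h1 : ∀ᶠ r in 𝓝 (0 : unitInterval), ∀ l ∈ (Set.univ : Set L), Q (l, r) ∈ U := by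
        refine isCompact_univ.eventually_forall_of_forall_eventually fun l _ => ?_
        have : Continuous fun z : unitInterval × L => Q (z.2, z.1) := by fun_prop
        exact this.continuousAt.eventually_mem (by simpa [hv] using hU)
      have h2 : Filter.Tendsto (fun p : unitInterval × (L × unitInterval) => τ p.1 p.2.2)
          (𝓝 (s, l, t)) (𝓝 0) := h0 ▸ hτc.tendsto (s, l, t)
      filter_upwards [h2.eventually h1] with p hp
      exact hp _ trivial
    · refine Q.continuous.continuousAt.comp (ContinuousAt.prodMk ?_ hτc.continuousAt)
      refine φ.symm.continuous.continuousAt.comp ?_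
      rw [IsInducing.subtypeVal.continuousAt_iff]
      refine ContinuousAt.smul (ContinuousAt.div ?_ ?_ fun h => h0 (Subtype.ext h)) ?_
      · exact Continuous.continuousAt (by fun_prop)
      · exact (continuous_subtype_val.comp hτc).continuousAt
      · exact Continuous.continuousAt (by fun_prop)
  -- `X` is glued from the cone and the closed complement of its open part. As a surjection from a
  -- compact space to a Hausdorff one, `P` is a quotient map, so the isotopy can be defined on the
  -- pieces.
  let P : (unitInterval × (L × unitInterval)) ⊕ (unitInterval × ↥(Sᶜ)) → unitInterval × X :=
    Sum.elim (fun p => (p.1, Q p.2)) (fun p => (p.1, p.2))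
  have hPc : Continuous P := by
    refine continuous_sum_dom.2 ⟨?_, ?_⟩
    · exact continuous_fst.prodMk (Q.continuous.comp continuous_snd)
    · exact continuous_fst.prodMk (continuous_subtype_val.comp continuous_snd)
  have hcov : ∀ x : X, (∃ l t, Q (l, t) = x) ∨ x ∈ Sᶜ := fun x => by
    by_cases hx : x ∈ S
    · obtain ⟨⟨l, t⟩, -, h⟩ := hx
      exact Or.inl ⟨l, t, h⟩
    · exact Or.inr hx
  have hPs : Function.Surjective P := by
    rintro ⟨s, x⟩
    rcases hcov x with ⟨l, t, rfl⟩ | hx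
    · exact ⟨Sum.inl (s, l, t), rfl⟩
    · exact ⟨Sum.inr (s, ⟨x, hx⟩), rfl⟩
  have hPq : IsQuotientMap P := IsQuotientMap.of_surjective_continuous hPs hPc
  let G : C((unitInterval × (L × unitInterval)) ⊕ (unitInterval × ↥(Sᶜ)), X) :=
    ⟨Sum.elim (fun p => Q (g p, τ p.1 p.2.2)) (fun p => p.2), continuous_sum_dom.2
      ⟨hGc, continuous_subtype_val.comp continuous_snd⟩⟩
  have hone : ∀ l t, Q (l, t) ∈ Sᶜ → t = 1 := fun l t h => by
    by_contra h1
    exact h ⟨(l, t), h1, rfl⟩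
  have hfac1 : ∀ s l t l' t', Q (l, t) = Q (l', t') →
      Q (g (s, l, t), τ s t) = Q (g (s, l', t'), τ s t') := fun s l t l' t' h => by
    obtain ⟨rfl, rfl | rfl⟩ := hQ _ _ _ _ h
    · congr 2
      simp [g]
    · rfl
  have hfac2 : ∀ s l t, Q (l, t) ∈ Sᶜ → Q (g (s, l, t), τ s t) = Q (l, t) := fun s l t h => by
    obtain rfl := hone l t h
    rw [hg1 s l 1 one_ne_zero (hττ1 s), hττ1]
  have hfac : Function.FactorsThrough G P := by
    rintro (⟨s, l, t⟩ | ⟨s, x⟩) (⟨s', l', t'⟩ | ⟨s', x'⟩) h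
    · obtain rfl : s = s' := congrArg Prod.fst h
      exact hfac1 s l t l' t' (congrArg Prod.snd h)
    · have h' : Q (l, t) = x' := congrArg Prod.snd h
      exact (hfac2 s l t (h' ▸ x'.2)).trans h'
    · have h' : (x : X) = Q (l', t') := congrArg Prod.snd h
      exact h'.trans (hfac2 s' l' t' (h' ▸ x.2)).symm
    · exact congrArg Prod.snd h
  let F : C(unitInterval × X, X) := IsQuotientMap.lift (f := ⟨P, hPc⟩) hPq G hfac
  have hF : ∀ p, F (P p) = G p := fun p =>
    DFunLike.congr_fun (IsQuotientMap.lift_comp (f := ⟨P, hPc⟩) hPq G hfac) p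
  have hF1 : ∀ s l t, F (s, Q (l, t)) = Q (g (s, l, t), τ s t) := fun s l t => hF (Sum.inl (s, l, t))
  have hF2 : ∀ s x, x ∈ Sᶜ → F (s, x) = x := fun s x hx => hF (Sum.inr (s, ⟨x, hx⟩))
  have hF3 : ∀ s l t x, x ∈ Sᶜ → F (s, Q (l, t)) = x → Q (l, t) = x := fun s l t x hx h => by
    rw [hF1] at h
    obtain rfl := hτ1 s t (hone _ _ (h ▸ hx))
    rwa [hg1 s l 1 one_ne_zero (hττ1 s), hττ1] at h
  refine ⟨F, fun s x y h => ?_, fun x => ?_, fun s x h => ?_⟩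
  · dsimp only at h
    rcases hcov x with ⟨l, t, rfl⟩ | hx <;> rcases hcov y with ⟨l', t', rfl⟩ | hy
    · rw [hF1, hF1] at h
      obtain ⟨h1, h2⟩ := hQ _ _ _ _ h
      obtain rfl := hτinj s t t' h1
      by_cases ht : t = 0
      · rw [ht, hv, hv]
      · rw [hg s l t ht l' (h2.resolve_left fun h => ht (hτ0 s t h).1)]
    · exact hF3 s l t y hy (by rw [h, hF2 s y hy])
    · exact (hF3 s l' t' x hx (by rw [← h, hF2 s x hx])).symm
    · rwa [hF2 s x hx, hF2 s y hy] at h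
  · rcases hcov x with ⟨l, t, rfl⟩ | hx
    · rw [hF1, hττ0]
      by_cases ht : t = 0
      · rw [ht, hv, hv]
      · rw [hg1 0 l t ht (hττ0 t)]
    · exact hF2 0 x hx
  · rcases hcov x with ⟨l, t, rfl⟩ | hx
    · rw [hF1, ← hv (g (s, l, t))] at h
      obtain ⟨rfl, rfl⟩ := hτ0 s t (hQ _ _ _ _ h).1
      exact ⟨rfl, hv l⟩
    · rw [hF2 s x hx] at h
      -- The disk is nonempty, so the apex `v` lies in `S` and cannot be a fixed point outside it.
      exact (hx ⟨(φ.symm ⟨0, by simp⟩, 0), zero_ne_one, (hv _).trans h.symm⟩).elim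
-- The closed star as a cone over the link
namespace Geometry.SimplicialComplex

variable {E : Type*} [NormedAddCommGroup E] [NormedSpace ℝ E] {K : Geometry.SimplicialComplex ℝ E}
  {s t : Finset E} {v x l : E}

theorem openSimplex_subset_convexHull : openSimplex s ⊆ convexHull ℝ (s : Set E) := by
  rintro x ⟨w, hw, h1, hx⟩
  exact Finset.mem_convexHull'.2 ⟨w, fun y hy => (hw y hy).le, h1, hx⟩

theorem sum_filter_pos_smul {ι : Type*} {s : Finset ι} {w : ι → ℝ} (hw : ∀ y ∈ s, 0 ≤ w y) {M : Type*} [AddCommGroup M]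
    [Module ℝ M] (f : ι → M) :
    ∑ y ∈ s with 0 < w y, w y • f y = ∑ y ∈ s, w y • f y := by
  refine Finset.sum_filter_of_ne fun y hy h => (hw y hy).lt_of_ne' fun h0 => h ?_
  rw [h0, zero_smul]

theorem sum_filter_pos {ι : Type*} {s : Finset ι} {w : ι → ℝ} (hw : ∀ y ∈ s, 0 ≤ w y) :
    ∑ y ∈ s with 0 < w y, w y = ∑ y ∈ s, w y := by
  simpa using sum_filter_pos_smul hw fun _ => (1 : ℝ)

/-- A convex combination lies in the open simplex spanned by the points of positive weight. -/
theorem mem_openSimplex_filter {w : E → ℝ} (hw : ∀ y ∈ s, 0 ≤ w y) (h1 : ∑ y ∈ s, w y = 1)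
    (hx : ∑ y ∈ s, w y • y = x) : x ∈ openSimplex (s.filter fun y => 0 < w y) :=
  ⟨w, fun _ hy => (Finset.mem_filter.1 hy).2, (sum_filter_pos hw).trans h1,
    (sum_filter_pos_smul hw id).trans hx⟩

theorem nonempty_of_mem_openSimplex (h : x ∈ openSimplex s) : s.Nonempty := by
  obtain ⟨w, -, h1, -⟩ := h
  rw [Finset.nonempty_iff_ne_empty]
  rintro rfl
  simp at h1

theorem exists_subset_mem_openSimplex (h : x ∈ convexHull ℝ (s : Set E)) :
    ∃ u ⊆ s, x ∈ openSimplex u := by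
  obtain ⟨w, hw, h1, hx⟩ := Finset.mem_convexHull'.1 h
  exact ⟨_, Finset.filter_subset _ _, mem_openSimplex_filter hw h1 hx⟩

/-- A face whose open simplex meets a closed simplex of the complex is a face of that simplex. -/
theorem subset_of_mem_openSimplex (hs : s ∈ K.faces) (ht : t ∈ K.faces) (hx : x ∈ openSimplex s)
    (hxt : x ∈ convexHull ℝ (t : Set E)) : s ⊆ t := by
  classical
  have hst := K.inter_subset_convexHull hs ht ⟨openSimplex_subset_convexHull hx, hxt⟩
  rw [← Finset.coe_inter] at hst
  obtain ⟨w, hw, h1, hwx⟩ := hx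
  obtain ⟨w', hw', h1', hwx'⟩ := Finset.mem_convexHull'.1 hst
  -- Extending the weights on `s ∩ t` by zero gives a second set of barycentric coordinates of `x`
  -- in `s`. Affine independence forces equality, so no positive weight sits outside `t`.
  have e1 : ∑ y ∈ s, (if y ∈ t then w' y else 0) = 1 := by
    rw [← Finset.sum_filter, Finset.filter_mem_eq_inter, h1']
  have e2 : ∑ y ∈ s, (if y ∈ t then w' y else 0) • y = x := by
    simp_rw [ite_smul, zero_smul]
    rw [← Finset.sum_filter, Finset.filter_mem_eq_inter, hwx']
  have key := affineIndependent_iff.1 (K.indep hs) Finset.univ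
    (fun y => w y - if (y : E) ∈ t then w' y else 0)
    (by rw [Finset.sum_coe_sort s fun y => w y - if y ∈ t then w' y else 0,
      Finset.sum_sub_distrib, h1, e1, sub_self])
    (by rw [Finset.sum_coe_sort s fun y => (w y - if y ∈ t then w' y else 0) • y]
        simp_rw [sub_smul]
        rw [Finset.sum_sub_distrib, hwx, e2, sub_self])
  intro y hy
  by_contra hyt
  have := key ⟨y, hy⟩ (Finset.mem_univ _)
  simp only [hyt, if_false, sub_zero] at this
  exact (hw y hy).ne' this

theorem mem_star_singleton :
    x ∈ K.star {v} ↔ ∃ s ∈ K.faces, v ∈ convexHull ℝ (s : Set E) ∧ x ∈ openSimplex s := by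
  simp [star, Set.inter_nonempty]

/-- The support of a proper mixture contains the support of `v`, so the face carrying the mixture
has `v` in its closure. -/
theorem openSegment_subset_star (hs : s ∈ K.faces) (hv : v ∈ convexHull ℝ (s : Set E))
    (hl : l ∈ convexHull ℝ (s : Set E)) : openSegment ℝ v l ⊆ K.star {v} := by
  rintro x ⟨a, b, ha, hb, hab, rfl⟩
  obtain ⟨w, hw, h1, hwv⟩ := Finset.mem_convexHull'.1 hv
  obtain ⟨w', hw', h1', hwl⟩ := Finset.mem_convexHull'.1 hl
  have hnn : ∀ y ∈ s, 0 ≤ a * w y + b * w' y := fun y hy =>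
    add_nonneg (mul_nonneg ha.le (hw y hy)) (mul_nonneg hb.le (hw' y hy))
  have hx : a • v + b • l ∈ openSimplex (s.filter fun y => 0 < a * w y + b * w' y) := by
    refine mem_openSimplex_filter hnn ?_ ?_
    · rw [Finset.sum_add_distrib, ← Finset.mul_sum, ← Finset.mul_sum, h1, h1', mul_one, mul_one, hab]
    · simp_rw [add_smul, mul_smul]
      rw [Finset.sum_add_distrib, ← Finset.smul_sum, ← Finset.smul_sum, hwv, hwl]
  refine mem_star_singleton.2 ⟨_, K.down_closed hs (Finset.filter_subset _ _)
    (nonempty_of_mem_openSimplex hx), ?_, hx⟩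
  refine convexHull_mono ?_ (openSimplex_subset_convexHull (mem_openSimplex_filter hw h1 hwv))
  intro y hy
  simp only [Finset.coe_filter, Set.mem_ofPred_eq] at hy ⊢
  exact ⟨hy.1, add_pos_of_pos_of_nonneg (mul_pos ha hy.2) (mul_nonneg hb.le (hw' y hy.1))⟩

/-- From a point of an open simplex one can move a little away from any point of the closed
simplex. -/
theorem exists_pos_add_smul_mem_convexHull (hl : l ∈ openSimplex s)
    (hv : v ∈ convexHull ℝ (s : Set E)) :
    ∃ ε : ℝ, 0 < ε ∧ l + ε • (l - v) ∈ convexHull ℝ (s : Set E) := by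
  -- The smallest weight of `l` serves as `ε`: the weights of `v` are at most `1`, so subtracting
  -- `ε` times them leaves nonnegative weights.
  obtain ⟨m, hm, hmin⟩ := Finset.exists_min_image s hl.choose (nonempty_of_mem_openSimplex hl)
  obtain ⟨hw', h1', hwl⟩ := hl.choose_spec
  set w' := hl.choose
  obtain ⟨w, hw, h1, hwv⟩ := Finset.mem_convexHull'.1 hv
  have hw1 : ∀ y ∈ s, w y ≤ 1 := fun y hy => h1 ▸ Finset.single_le_sum hw hy
  refine ⟨w' m, hw' m hm, Finset.mem_convexHull'.2 ⟨fun y => w' y + w' m * (w' y - w y), ?_, ?_, ?_⟩⟩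
  · intro y hy
    have h2 := mul_le_mul_of_nonneg_left (hw1 y hy) (hw' m hm).le
    have h3 := mul_nonneg (hw' m hm).le (hw' y hy).le
    have h4 := hmin y hy
    linarith
  · rw [Finset.sum_add_distrib, ← Finset.mul_sum, Finset.sum_sub_distrib, h1, h1']
    ring
  · simp_rw [add_smul, mul_smul, sub_smul]
    rw [Finset.sum_add_distrib, ← Finset.smul_sum, Finset.sum_sub_distrib, hwv, hwl]

theorem mem_star_self (hv : v ∈ K.space) : v ∈ K.star {v} := by
  obtain ⟨s, hs, hvs⟩ := mem_space_iff.1 hv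
  simpa using openSegment_subset_star hs hvs hvs

theorem mem_convexHull_of_mem_star (ht : t ∈ K.faces) (hx : x ∈ K.star {v})
    (hxt : x ∈ convexHull ℝ (t : Set E)) : v ∈ convexHull ℝ (t : Set E) := by
  obtain ⟨s, hs, hvs, hxs⟩ := mem_star_singleton.1 hx
  exact convexHull_mono (by exact_mod_cast subset_of_mem_openSimplex hs ht hxs hxt) hvs

theorem isClosed_biUnion_convexHull (hK : K.faces.Finite) (p : Finset E → Prop) :
    IsClosed (⋃ s ∈ {s ∈ K.faces | p s}, convexHull ℝ (s : Set E)) :=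
  (hK.subset (Set.sep_subset _ _)).isClosed_biUnion fun s _ => s.finite_toSet.isClosed_convexHull ℝ

theorem isCompact_space (hK : K.faces.Finite) : IsCompact K.space :=
  hK.isCompact_biUnion fun s _ => s.finite_toSet.isCompact_convexHull ℝ

/-- With finitely many faces this exhibits the complement of the star as closed, so the star is open
in the complex. -/
theorem space_diff_star_eq : K.space \ K.star {v} =
    ⋃ s ∈ {s ∈ K.faces | v ∉ convexHull ℝ (s : Set E)}, convexHull ℝ (s : Set E) := by
  ext x
  simp only [Set.mem_sdiff, Set.mem_iUnion, Set.mem_ofPred_eq, exists_prop]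
  constructor
  · rintro ⟨hx, hxs⟩
    obtain ⟨s, hs, hx⟩ := mem_space_iff.1 hx
    obtain ⟨u, hu, hxu⟩ := exists_subset_mem_openSimplex hx
    have huK := K.down_closed hs hu (nonempty_of_mem_openSimplex hxu)
    exact ⟨u, ⟨huK, fun hv => hxs (mem_star_singleton.2 ⟨u, huK, hv, hxu⟩)⟩,
      openSimplex_subset_convexHull hxu⟩
  · rintro ⟨s, ⟨hs, hv⟩, hx⟩
    exact ⟨convexHull_subset_space hs hx, fun h => hv (mem_convexHull_of_mem_star hs h hx)⟩

theorem mem_closure_star_iff (hK : K.faces.Finite) : x ∈ closure (K.star {v}) ↔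
    ∃ s ∈ K.faces, v ∈ convexHull ℝ (s : Set E) ∧ x ∈ convexHull ℝ (s : Set E) := by
  constructor
  · intro hx
    have : x ∈ ⋃ s ∈ {s ∈ K.faces | v ∈ convexHull ℝ (s : Set E)}, convexHull ℝ (s : Set E) := by
      refine closure_minimal ?_ (isClosed_biUnion_convexHull hK _) hx
      intro y hy
      obtain ⟨s, hs, hv, hy⟩ := mem_star_singleton.1 hy
      exact Set.mem_biUnion (show s ∈ {s ∈ K.faces | _} from ⟨hs, hv⟩)
        (openSimplex_subset_convexHull hy)
    simpa [and_assoc] using this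
  · rintro ⟨s, hs, hv, hx⟩
    exact closure_mono (openSegment_subset_star hs hv hx)
      (segment_subset_closure_openSegment (right_mem_segment ℝ v x))

theorem mem_link_iff (hK : K.faces.Finite) : x ∈ K.link {v} ↔ (∃ s ∈ K.faces,
    v ∈ convexHull ℝ (s : Set E) ∧ x ∈ convexHull ℝ (s : Set E)) ∧ x ∉ K.star {v} := by
  rw [link, Set.mem_sdiff, mem_closure_star_iff hK, closure_singleton]

/-- The closed star is covered by the segments joining the centre to the link. -/
theorem exists_mem_link_lineMap (hK : K.faces.Finite) (hs : s ∈ K.faces)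
    (hv : v ∈ convexHull ℝ (s : Set E)) (hx : x ∈ convexHull ℝ (s : Set E)) (hxv : x ≠ v) :
    ∃ l ∈ K.link {v}, ∃ r ∈ Set.Ioc (0 : ℝ) 1, AffineMap.lineMap v l r = x := by
  have hd : 0 < ‖x - v‖ := norm_pos_iff.2 (sub_ne_zero.2 hxv)
  have hcomp := s.finite_toSet.isCompact_convexHull ℝ
  -- The ray from `v` through `x` leaves the compact simplex at a last point. That point is in the
  -- link: were it in the star, it could be pushed further along the ray.
  let A : Set ℝ := {r | v + r • (x - v) ∈ convexHull ℝ (s : Set E)}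
  have hA : IsCompact A := by
    refine Metric.isCompact_of_isClosed_isBounded
      (hcomp.isClosed.preimage (f := fun r : ℝ => v + r • (x - v)) (by fun_prop)) ?_
    obtain ⟨C, hC⟩ := hcomp.isBounded.exists_norm_le
    refine isBounded_iff_forall_norm_le.2 ⟨(C + C) / ‖x - v‖, fun r hr => ?_⟩
    rw [le_div_iff₀ hd, ← norm_smul]
    calc ‖r • (x - v)‖ = ‖(v + r • (x - v)) - v‖ := by rw [add_sub_cancel_left]
      _ ≤ _ := (norm_sub_le _ _).trans (add_le_add (hC _ hr) (hC _ hv))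
  have h1 : (1 : ℝ) ∈ A := by simpa [A] using hx
  obtain ⟨r, hr, hmax⟩ := hA.exists_isGreatest ⟨1, h1⟩
  have hr1 : 1 ≤ r := hmax h1
  have hr0 : 0 < r := one_pos.trans_le hr1
  refine ⟨v + r • (x - v), (mem_link_iff hK).2 ⟨⟨s, hs, hv, hr⟩, fun hst => ?_⟩, r⁻¹,
    ⟨inv_pos.2 hr0, inv_le_one_of_one_le₀ hr1⟩, ?_⟩
  · obtain ⟨u, hu, hvu, hlu⟩ := mem_star_singleton.1 hst
    obtain ⟨ε, hε, h⟩ := exists_pos_add_smul_mem_convexHull hlu hvu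
    have h' := convexHull_mono (𝕜 := ℝ)
      (Finset.coe_subset.2 (subset_of_mem_openSimplex hu hs hlu hr)) h
    have : r + ε * r ∈ A := by
      show v + (r + ε * r) • (x - v) ∈ convexHull ℝ (s : Set E)
      convert h' using 1
      rw [add_sub_cancel_left, smul_smul, add_smul, add_assoc]
    have := hmax this
    nlinarith [mul_pos hε hr0]
  · rw [AffineMap.lineMap_apply, vsub_eq_sub, add_sub_cancel_left, smul_smul,
      inv_mul_cancel₀ hr0.ne', one_smul, vadd_eq_add, sub_add_cancel]

theorem lineMap_mem_star (hK : K.faces.Finite) (hv : v ∈ K.space) (hl : l ∈ K.link {v}) {r : ℝ}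
    (hr : r ∈ Set.Ico (0 : ℝ) 1) : AffineMap.lineMap v l r ∈ K.star {v} := by
  obtain ⟨⟨s, hs, hvs, hls⟩, -⟩ := (mem_link_iff hK).1 hl
  rcases hr.1.eq_or_lt with rfl | h0
  · simpa using mem_star_self hv
  · exact openSegment_subset_star hs hvs hls (lineMap_mem_openSegment ℝ v l ⟨h0, hr.2⟩)

/-- If `r < r'`, then `l'` lies on the segment from `v` to `l` strictly before `l`, hence in the
star, which the link avoids. -/
theorem lineMap_link_le (hK : K.faces.Finite) (hv : v ∈ K.space) {l' : E}
    (hl : l ∈ K.link {v}) (hl' : l' ∈ K.link {v}) {r r' : ℝ} (hr : 0 ≤ r) (hr' : 0 ≤ r')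
    (h : AffineMap.lineMap v l r = AffineMap.lineMap v l' r') : r' ≤ r := by
  by_contra! hlt
  refine ((mem_link_iff hK).1 hl').2 ?_
  have h0 : 0 < r' := hr.trans_lt hlt
  have : l' = AffineMap.lineMap v l (r / r') := by
    simp only [AffineMap.lineMap_apply, vsub_eq_sub, vadd_eq_add, add_left_inj] at h ⊢
    rw [div_eq_inv_mul, mul_smul, h, smul_smul, inv_mul_cancel₀ h0.ne', one_smul, sub_add_cancel]
  rw [this]
  exact lineMap_mem_star hK hv hl ⟨div_nonneg hr hr', (div_lt_one h0).2 hlt⟩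

theorem eq_of_lineMap_link (hK : K.faces.Finite) (hv : v ∈ K.space) {l' : E}
    (hl : l ∈ K.link {v}) (hl' : l' ∈ K.link {v}) {r r' : ℝ} (hr : 0 ≤ r) (hr' : 0 ≤ r')
    (h : AffineMap.lineMap v l r = AffineMap.lineMap v l' r') : r = r' ∧ (r = 0 ∨ l = l') := by
  obtain rfl : r = r' := le_antisymm (lineMap_link_le hK hv hl' hl hr' hr h.symm)
    (lineMap_link_le hK hv hl hl' hr hr' h)
  refine ⟨rfl, or_iff_not_imp_left.2 fun h0 => ?_⟩
  simp only [AffineMap.lineMap_apply, vsub_eq_sub, vadd_eq_add, add_left_inj] at h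
  exact sub_left_injective (smul_right_injective E h0 h)

theorem lineMap_mem_space (hK : K.faces.Finite) (hl : l ∈ K.link {v}) {r : ℝ}
    (hr : r ∈ Set.Icc (0 : ℝ) 1) : AffineMap.lineMap v l r ∈ K.space := by
  obtain ⟨⟨s, hs, hvs, hls⟩, -⟩ := (mem_link_iff hK).1 hl
  exact convexHull_subset_space hs ((convex_convexHull ℝ _).lineMap_mem hvs hls hr)

/-- The closed star of a point as a cone over its link. -/
def linkCone (K : Geometry.SimplicialComplex ℝ E) (hK : K.faces.Finite) (v : K.space) :
    C(K.link {(v : E)} × unitInterval, K.space) where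
  toFun p := ⟨AffineMap.lineMap (v : E) (p.1 : E) (p.2 : ℝ), lineMap_mem_space hK p.1.2 p.2.2⟩
  continuous_toFun := Continuous.subtype_mk (by
    simp only [AffineMap.lineMap_apply, vsub_eq_sub, vadd_eq_add]
    fun_prop) _

/-- Identifies the open cone with the star, whence its openness. A nonempty link is needed for the
apex `v` to be attained. -/
theorem image_linkCone (hK : K.faces.Finite) (v : K.space) (hL : (K.link {(v : E)}).Nonempty) :
    K.linkCone hK v '' {p | p.2 ≠ 1} = (Subtype.val ⁻¹' (K.space \ K.star {(v : E)}))ᶜ := by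
  ext x
  simp only [Set.mem_image, Set.mem_ofPred_eq, Set.mem_compl_iff, Set.mem_preimage, Set.mem_sdiff,
    x.2, true_and, not_not]
  constructor
  · rintro ⟨⟨l, t⟩, ht, rfl⟩
    exact lineMap_mem_star hK v.2 l.2 ⟨t.2.1, t.2.2.lt_of_ne fun h => ht (Subtype.ext h)⟩
  · intro hx
    obtain ⟨s, hs, hvs, hxs⟩ := mem_star_singleton.1 hx
    by_cases hxv : (x : E) = v
    · obtain ⟨l, hl⟩ := hL
      exact ⟨(⟨l, hl⟩, 0), zero_ne_one, Subtype.ext (by simp [linkCone, hxv])⟩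
    · obtain ⟨l, hl, r, hr, h⟩ :=
        exists_mem_link_lineMap hK hs hvs (openSimplex_subset_convexHull hxs) hxv
      refine ⟨(⟨l, hl⟩, ⟨r, hr.1.le, hr.2⟩), fun h1 => ?_, Subtype.ext h⟩
      have h1 : r = 1 := congrArg Subtype.val h1
      rw [h1, AffineMap.lineMap_apply_one] at h
      exact ((mem_link_iff hK).1 hl).2 (h ▸ hx)

/-- A boundary point of a finite complex can be pushed off itself by an isotopy of embeddings. -/
theorem IsBoundaryPoint.exists_isotopy (hK : K.faces.Finite) {v : K.space}
    (hv : K.IsBoundaryPoint (v : E)) :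
    ∃ F : C(unitInterval × K.space, K.space), (∀ s, Function.Injective fun x => F (s, x)) ∧
      (∀ x, F (0, x) = x) ∧ ∀ s x, F (s, x) = v → s = 0 ∧ x = v := by
  obtain ⟨-, k, ⟨φ⟩⟩ := hv
  have : CompactSpace K.space := isCompact_iff_compactSpace.1 (isCompact_space hK)
  refine exists_isotopy_of_cone φ (K.linkCone hK v) (fun l => Subtype.ext ?_)
    (fun l t l' t' h => ?_) ?_
  · simp [linkCone]
  · obtain ⟨h1, h2⟩ := eq_of_lineMap_link hK v.2 l.2 l'.2 t.2.1 t'.2.1 (congrArg Subtype.val h)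
    exact ⟨Subtype.ext h1, h2.imp (fun h => Subtype.ext h) fun h => Subtype.ext h⟩
  · rw [image_linkCone hK v ⟨_, (φ.symm ⟨0, by simp⟩).2⟩, space_diff_star_eq]
    exact ((isClosed_biUnion_convexHull hK _).preimage continuous_subtype_val).isOpen_compl

end Geometry.SimplicialComplex

/-! ### The theorem -/

theorem mainTheorem12 {E : Type*} [NormedAddCommGroup E] [NormedSpace ℝ E]
    (K : Geometry.SimplicialComplex ℝ E) (hK : K.IsFiniteConnectedPosDim)
    (v : K.space) (hv : K.IsBoundaryPoint (v : E)) (n : ℕ) :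
    -- `(i_v)_* : π₁(B_n(X ∖ {v}), c) → π₁(B_{n+1}(X), {v} ∪ c)` is injective
    (∀ c : UnorderedConf n {x : K.space // x ≠ v},
      Function.Injective
        (FundamentalGroup.map (UnorderedConf.append n v) c :
          BraidGroup n {x : K.space // x ≠ v} c →*
            BraidGroup (n + 1) K.space (UnorderedConf.append n v c))) ∧
    -- the inclusion `B_n(X ∖ {v}) → B_n(X)` is a homotopy equivalence
    (∃ e : ContinuousMap.HomotopyEquiv
        (UnorderedConf n {x : K.space // x ≠ v}) (UnorderedConf n K.space),
      e.toFun = UnorderedConf.inclusion n v) ∧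
    -- for any homotopy inverse `h` of it, `(i_v ∘ h)_* : π₁(B_n(X), c) → π₁(B_{n+1}(X))`
    -- is injective
    (∀ e : ContinuousMap.HomotopyEquiv
        (UnorderedConf n {x : K.space // x ≠ v}) (UnorderedConf n K.space),
      e.toFun = UnorderedConf.inclusion n v →
      ∀ c : UnorderedConf n K.space,
        Function.Injective
          (FundamentalGroup.map ((UnorderedConf.append n v).comp e.invFun) c :
            BraidGroup n K.space c →*
              BraidGroup (n + 1) K.space (UnorderedConf.append n v (e.invFun c)))) := by
  obtain ⟨F, hF, h0, hFv⟩ := hv.exists_isotopy hK.finite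
  obtain ⟨e, he⟩ := UnorderedConf.exists_homotopyEquiv_inclusion n F hF h0 hFv
  have happ := fun c => UnorderedConf.map_append_injective (v := v) c
    (he ▸ FundamentalGroup.map_injective_of_comp_homotopic_id e.left_inv c)
  refine ⟨happ, ⟨e, he⟩, fun e _ c => ?_⟩
  intro a b hab
  refine FundamentalGroup.map_injective_of_comp_homotopic_id e.right_inv c
    (happ (e.invFun c) ?_)
  -- On representing paths, the map induced by the composite is definitionally the composite of the
  -- induced maps.
  obtain ⟨a⟩ := a
  obtain ⟨b⟩ := b
  exact hab
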